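/- Fix a dimension $d\ge 1$. For an even positive integer $N$ let $\mathbb{T}_N$ be the discrete torus with vertex set $\mathbb{B}_N=\{-N/2+1,\dots,N/2\}^d$, where $\{\mathbf i,\mathbf j\}$ is an edge if $\mathbf j-\mathbf i\in\{\mathbf e_k,-(N-1)\mathbf e_k: 1\le k\le d\}$. On $(\mathbb{C}^2)^{\otimes \mathbb{B}_N}$ let $$H_{N,\Delta}=-\sum_{\{\mathbf i,\mathbf j\}}\left(S^x_{\mathbf i}S^x_{\mathbf j}+S^y_{\mathbf i}S^y_{\mathbf j}+\Delta\, S^z_{\mathbf i}S^z_{\mathbf j}\right),$$ the sum being over the edges of $\mathbb{T}_N$ and $S^x,S^y,S^z$ being $\frac12$ times the Pauli matrices, and let $$\langle X\rangle_{N,\Delta,\beta}=\frac{\operatorname{tr}(Xe^{-\beta H_{N,\Delta}})}{\operatorname{tr}(e^{-\beta H_{N,\Delta}})}.$$ For a positive integer $L$ let $\tau^{(L,N)}\in\{-1,+1\}^{\mathbb{B}_N}$ be the block checkerboard configuration $$\tau^{(L,N)}_{\mathbf i}=(-1)^{\lfloor (2i_1-1)/(2L)\rfloor+\dots+\lfloor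 (2i_d-1)/(2L)\rfloor},$$ let $\Psi_N(\tau^{(L,N)})$ be the corresponding vector of the product basis of eigenvectors of the $S^z_{\mathbf i}$ (with eigenvalue $\frac12\tau^{(L,N)}_{\mathbf i}$ at the site $\mathbf i$), and let $\widehat{\mathbf Q}_{N,L}=|\Psi_N(\tau^{(L,N)})\rangle\langle\Psi_N(\tau^{(L,N)})|$ (the ``universal contour''). Theorem. For each $\Delta<1$ there exist $L_0\in\{1,2,\dots\}$ and $C,c>0$ (depending only on $d$ and $\Delta$) such that for all integers $L\ge L_0$, all even $N\ge 32dL$ and all $\beta\ge 0$, $$\langle\widehat{\mathbf Q}_{N,L}\rangle_{N,\Delta,\beta}\le C\,e^{-cN^d\min(L,\beta)}.$$ -/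

import Mathlib

open scoped BigOperators

namespace XXZ

/-! ### Spin-1/2 systems

For a finite set `V` of sites the Hilbert space `(ℂ²)^{⊗ V}` is written in the product basis: its
basis vectors are indexed by `V → Fin 2`, where `0` is spin up (`+1`) and `1` is spin down (`-1`).
Operators are matrices in this basis. -/

/-- The spin matrix `Sˣ`. -/
noncomputable def Sx : Matrix (Fin 2) (Fin 2) ℂ := (1 / 2 : ℂ) • !![0, 1; 1, 0]

/-- The spin matrix `Sʸ`. -/
noncomputable def Sy : Matrix (Fin 2) (Fin 2) ℂ :=
  (1 / 2 : ℂ) • !![0, -Complex.I; Complex.I, 0]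

/-- The spin matrix `Sᶻ`. -/
noncomputable def Sz : Matrix (Fin 2) (Fin 2) ℂ := (1 / 2 : ℂ) • !![1, 0; 0, -1]

/-- Operators on `(ℂ²)^{⊗ V}`. -/
abbrev Operator (V : Type*) : Type _ := Matrix (V → Fin 2) (V → Fin 2) ℂ

section General

variable {V : Type*} [Fintype V] [DecidableEq V]

/-- The operator `I ⊗ ⋯ ⊗ I ⊗ A ⊗ I ⊗ ⋯ ⊗ I` on `(ℂ²)^{⊗ V}`, with `A` acting at the site `i`. -/
def siteOp (A : Matrix (Fin 2) (Fin 2) ℂ) (i : V) : Operator V :=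
  Matrix.of fun σ τ => if ∀ j, j ≠ i → σ j = τ j then A (σ i) (τ i) else 0

theorem siteOp_mul_apply {i j : V} (hij : i ≠ j) (A B : Matrix (Fin 2) (Fin 2) ℂ)
    (σ τ : V → Fin 2) :
    (siteOp A i * siteOp B j) σ τ =
      if ∀ k, k ≠ i → k ≠ j → σ k = τ k then A (σ i) (τ i) * B (σ j) (τ j) else 0 := by
  rw [Matrix.mul_apply, Finset.sum_eq_single (Function.update σ i (τ i))]
  · have h1 : ∀ k, k ≠ i → σ k = Function.update σ i (τ i) k := by
      intro k hk; simp [hk]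
    have h2 : (∀ k, k ≠ j → Function.update σ i (τ i) k = τ k) ↔
        (∀ k, k ≠ i → k ≠ j → σ k = τ k) := by
      constructor
      · intro h k hki hkj
        simpa [hki] using h k hkj
      · intro h k hkj
        by_cases hki : k = i
        · subst hki; simp
        · simpa [hki] using h k hki hkj
    simp only [siteOp, Matrix.of_apply, if_pos h1, h2, Function.update_self,
      Function.update_of_ne hij.symm]
    split_ifs <;> simp
  · intro ρ _ hρ
    simp only [siteOp, Matrix.of_apply]
    split_ifs with h1 h2
    · exfalso
      apply hρ
      funext k
      by_cases hk : k = i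
      · subst hk; simpa using h2 k hij
      · simpa [hk] using (h1 k hk).symm
    all_goals simp
  · intro h; exact absurd (Finset.mem_univ _) h

theorem siteOp_mul_comm (A : Matrix (Fin 2) (Fin 2) ℂ) (i j : V) :
    siteOp A i * siteOp A j = siteOp A j * siteOp A i := by
  by_cases hij : i = j
  · subst hij; rfl
  · ext σ τ
    rw [siteOp_mul_apply hij, siteOp_mul_apply (Ne.symm hij)]
    have : (∀ k, k ≠ i → k ≠ j → σ k = τ k) ↔ (∀ k, k ≠ j → k ≠ i → σ k = τ k) :=
      ⟨fun h k a b => h k b a, fun h k a b => h k b a⟩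
    simp only [this, mul_comm (A (σ i) (τ i))]

/-- The interaction `Sˣᵢ Sˣⱼ + Sʸᵢ Sʸⱼ + Δ Sᶻᵢ Sᶻⱼ` of an unordered pair `{i, j}`. -/
noncomputable def bond (Δ : ℝ) : Sym2 V → Operator V :=
  Sym2.lift ⟨fun i j => siteOp Sx i * siteOp Sx j + siteOp Sy i * siteOp Sy j
      + (Δ : ℂ) • (siteOp Sz i * siteOp Sz j), fun i j => by
    simp only [siteOp_mul_comm _ i j]⟩

open Classical in
/-- The XXZ Hamiltonian of a finite graph with anisotropy `Δ`. -/
noncomputable def hamiltonian (G : SimpleGraph V) (Δ : ℝ) : Operator V :=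
  -∑ e ∈ G.edgeFinset, bond Δ e

/-- The Boltzmann operator `exp (-β H)`. -/
noncomputable def boltzmann (G : SimpleGraph V) (Δ β : ℝ) : Operator V :=
  NormedSpace.exp ((-β : ℂ) • hamiltonian G Δ)

/-- The partition function `tr (exp (-β H))`. -/
noncomputable def partitionFunction (G : SimpleGraph V) (Δ β : ℝ) : ℂ :=
  (boltzmann G Δ β).trace

/-- The equilibrium state `⟨X⟩ = tr (X exp (-β H)) / Z`. -/
noncomputable def gibbs (G : SimpleGraph V) (Δ β : ℝ) (X : Operator V) : ℂ :=
  (X * boltzmann G Δ β).trace / partitionFunction G Δ β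

/-- The basis vector of `(ℂ²)^{⊗ V}` that belongs to a spin configuration `τ ∈ {-1, +1}^V`. -/
def basisVec (τ : V → ℤˣ) : (V → Fin 2) → ℂ :=
  Pi.single (fun i => if τ i = 1 then 0 else 1) 1

/-- The rank-one projection `|Ψ(τ)⟩⟨Ψ(τ)|`. -/
def rankOneProj (τ : V → ℤˣ) : Operator V :=
  Matrix.vecMulVec (basisVec τ) (star (basisVec τ))

end General

/-! ### The discrete torus and the universal contour -/

/-- The box `{-⌈N/2⌉ + 1, …, ⌊N/2⌋}^d`. -/
noncomputable def box (d N : ℕ) : Finset (Fin d → ℤ) :=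
  Fintype.piFinset fun _ => Finset.Icc (-⌈(N : ℚ) / 2⌉ + 1) ⌊(N : ℚ) / 2⌋

/-- The discrete torus: the box, where `{i, j}` is an edge if
`j - i ∈ {e₁, …, e_d, -(N-1) e₁, …, -(N-1) e_d}`. -/
noncomputable def torus (d N : ℕ) : SimpleGraph (box d N) :=
  SimpleGraph.fromRel fun i j => ∃ k : Fin d,
    (j : Fin d → ℤ) - (i : Fin d → ℤ) = Pi.single k 1 ∨
    (j : Fin d → ℤ) - (i : Fin d → ℤ) = Pi.single k (-((N : ℤ) - 1))

/-- The configuration `τᵢ = (-1)^(⌊(2 i₁ - 1)/(2 L)⌋ + ⋯ + ⌊(2 i_d - 1)/(2 L)⌋)`. -/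
noncomputable def blockConfig (d N L : ℕ) : box d N → ℤˣ := fun i =>
  (-1) ^ ∑ k : Fin d, ⌊(2 * ((i : Fin d → ℤ) k : ℚ) - 1) / (2 * (L : ℚ))⌋

/-- The universal contour: the rank-one projection onto the block checkerboard configuration. -/
noncomputable def universalContour (d N L : ℕ) : Operator (box d N) :=
  rankOneProj (blockConfig d N L)

end XXZ

/-!
Write `B = -H`. It is a real symmetric matrix with nonnegative off-diagonal entries, and the claim
concerns `exp (β B) s s / tr (exp (β B))`, where `s` is the block checkerboard configuration.

*The partition function.* In the product state with all spins in the `x` direction every bond has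
expected energy `-1/4`, so the largest eigenvalue of `B` is at least `|E| / 4`, where `E` is the set of
edges. By the spectral theorem (`exp_apply_div_trace_le`) the ratio above is then at most
`exp (-t |E| / 4) * exp (t B) s s` for every `t ≤ β`. Thus it suffices to bound `exp (t B) s s` for
times `t` up to a small multiple of `L`.

*The numerator.* If all spins were parallel, the entry would be `exp (t Δ |E| / 4)`, which is
exponentially smaller than `exp (t |E| / 4)` because `Δ < 1`. The configuration `s` has few
antiparallel edges, and the point is that their number stays small for times up to order `L`. Give
each site a weight `w`, its distance to the block boundaries, and let `Φ σ` be the total weight of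
the sites where `σ` and `s` differ. The operator `B` only exchanges neighbouring antiparallel spins,
which changes `Φ` by at most `1` (`mismatch_swap_le`), and a configuration `σ` has at most
`D (Φ σ / r + #{w < r})` antiparallel edges (`card_antiparallel_le`), where `D` bounds the degrees.
Consequently, for `θ t = 1 - t / T` with `T` a small multiple of `r`, the function
`∑ σ, exp (θ t * Φ σ) * exp (t B) σ s` grows at a rate of at most `Δ |E| / 4 + O(#{w < r})` up to
time `T`: the loss due to the decrease of `θ` absorbs the term `Φ σ / r`. This is
`exp_negHamiltonian_apply_le`.

With `r = η L` only a fraction of order `η` of all sites has weight less than `r`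
(`card_siteWeight_lt_le`), so for small `η` the energy gap `(1 - Δ) |E| / 4` wins.
-/

namespace XXZ

/-! ### The Hamiltonian as a real matrix -/

section General

variable {V : Type*} [Fintype V] [DecidableEq V]

/-- The bond interaction as a real matrix. -/
noncomputable def realBond (Δ : ℝ) (e : Sym2 V) : Matrix (V → Fin 2) (V → Fin 2) ℝ :=
  (bond Δ e).map Complex.re

theorem bond_apply (Δ : ℝ) {i j : V} (hij : i ≠ j) (σ ρ : V → Fin 2) :
    bond Δ s(i, j) σ ρ =
      (((if σ = ρ then (if ρ i = ρ j then Δ / 4 else -Δ / 4) else 0) +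
        if ρ i ≠ ρ j ∧ σ = ρ ∘ Equiv.swap i j then 1 / 2 else 0 : ℝ) : ℂ) := by
  simp only [bond, Sym2.lift_mk, Matrix.add_apply, Matrix.smul_apply, siteOp_mul_apply hij]
  by_cases h : ∀ k, k ≠ i → k ≠ j → σ k = ρ k
  · have h1 : σ = ρ ↔ σ i = ρ i ∧ σ j = ρ j := by
      refine ⟨by rintro rfl; simp, fun ⟨a, b⟩ => funext fun k => ?_⟩
      by_cases hi : k = i
      · rw [hi, a]
      by_cases hj : k = j
      · rw [hj, b]
      exact h k hi hj
    have h2 : σ = ρ ∘ Equiv.swap i j ↔ σ i = ρ j ∧ σ j = ρ i := by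
      refine ⟨by rintro rfl; simp, fun ⟨a, b⟩ => funext fun k => ?_⟩
      by_cases hi : k = i
      · simp [hi, a]
      by_cases hj : k = j
      · simp [hj, b]
      simp [Equiv.swap_apply_of_ne_of_ne hi hj, h k hi hj]
    simp only [if_pos h, h1, h2]
    generalize σ i = a
    generalize σ j = b
    generalize ρ i = a'
    generalize ρ j = b'
    fin_cases a <;> fin_cases b <;> fin_cases a' <;> fin_cases b' <;>
      simp [Sx, Sy, Sz] <;> ring_nf <;> simp <;> ring
  · have h1 : σ ≠ ρ := by rintro rfl; exact h fun _ _ _ => rfl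
    have h2 : σ ≠ ρ ∘ Equiv.swap i j := by
      rintro rfl
      exact h fun k hi hj => by simp [Equiv.swap_apply_of_ne_of_ne hi hj]
    simp [h, h1, h2]

theorem realBond_apply (Δ : ℝ) {i j : V} (hij : i ≠ j) (σ ρ : V → Fin 2) :
    realBond Δ s(i, j) σ ρ =
      (if σ = ρ then (if ρ i = ρ j then Δ / 4 else -Δ / 4) else 0) +
        if ρ i ≠ ρ j ∧ σ = ρ ∘ Equiv.swap i j then 1 / 2 else 0 := by
  rw [realBond, Matrix.map_apply, bond_apply Δ hij, Complex.ofReal_re]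

theorem map_realBond (Δ : ℝ) {e : Sym2 V} (he : ¬ e.IsDiag) :
    (realBond Δ e).map Complex.ofReal = bond Δ e := by
  induction e with | _ i j
  ext σ ρ
  rw [Matrix.map_apply, realBond_apply Δ (by simpa using he), bond_apply Δ (by simpa using he)]

theorem realBond_symm (Δ : ℝ) {e : Sym2 V} (he : ¬ e.IsDiag) (σ ρ : V → Fin 2) :
    realBond Δ e σ ρ = realBond Δ e ρ σ := by
  induction e with | _ i j
  have hij : i ≠ j := by simpa using he
  rw [realBond_apply Δ hij, realBond_apply Δ hij]
  have key : ∀ σ ρ : V → Fin 2, ρ i ≠ ρ j ∧ σ = ρ ∘ Equiv.swap i j →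
      σ i ≠ σ j ∧ ρ = σ ∘ Equiv.swap i j := by
    rintro σ ρ ⟨h, rfl⟩
    refine ⟨by simpa using h.symm, ?_⟩
    funext k
    simp
  congr 1
  · by_cases h : σ = ρ
    · subst h; rfl
    · simp [h, Ne.symm h]
  · exact if_congr ⟨key σ ρ, key ρ σ⟩ rfl rfl

theorem realBond_nonneg (Δ : ℝ) {e : Sym2 V} (he : ¬ e.IsDiag) {σ ρ : V → Fin 2} (h : σ ≠ ρ) :
    0 ≤ realBond Δ e σ ρ := by
  induction e with | _ i j
  rw [realBond_apply Δ (by simpa using he), if_neg h]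
  positivity

theorem sum_mul_realBond (Δ : ℝ) {i j : V} (hij : i ≠ j) (f : (V → Fin 2) → ℝ) (ρ : V → Fin 2) :
    ∑ σ, f σ * realBond Δ s(i, j) σ ρ =
      Δ / 4 * f ρ + if ρ i = ρ j then 0 else (f (ρ ∘ Equiv.swap i j) - Δ * f ρ) / 2 := by
  simp only [realBond_apply Δ hij, mul_add, Finset.sum_add_distrib, mul_ite, mul_zero,
    Finset.sum_ite_eq', Finset.mem_univ, if_true]
  by_cases h : ρ i = ρ j
  · simp [h, mul_comm]
  · simp [h]
    ring

/-- The operator `-H` as a real matrix. -/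
noncomputable def negHamiltonian (G : SimpleGraph V) (Δ : ℝ) :
    Matrix (V → Fin 2) (V → Fin 2) ℝ :=
  open Classical in ∑ e ∈ G.edgeFinset, realBond Δ e

theorem map_negHamiltonian (G : SimpleGraph V) (Δ : ℝ) :
    (negHamiltonian G Δ).map Complex.ofReal = -hamiltonian G Δ := by
  classical
  rw [hamiltonian, neg_neg, negHamiltonian]
  ext σ ρ
  simp only [Matrix.map_apply, Matrix.sum_apply, Complex.ofReal_sum]
  refine Finset.sum_congr (by congr!) fun e he => ?_
  rw [← map_realBond Δ (G.not_isDiag_of_mem_edgeSet (by simpa using he)), Matrix.map_apply]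

theorem negHamiltonian_isHermitian (G : SimpleGraph V) (Δ : ℝ) :
    (negHamiltonian G Δ).IsHermitian := by
  classical
  ext σ ρ
  simp only [negHamiltonian, Matrix.conjTranspose_apply, Matrix.sum_apply, star_trivial]
  exact Finset.sum_congr rfl fun e he =>
    realBond_symm Δ (G.not_isDiag_of_mem_edgeSet (by simpa using he)) _ _

theorem negHamiltonian_nonneg (G : SimpleGraph V) (Δ : ℝ) {σ ρ : V → Fin 2} (h : σ ≠ ρ) :
    0 ≤ negHamiltonian G Δ σ ρ := by
  classical
  simp only [negHamiltonian, Matrix.sum_apply]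
  exact Finset.sum_nonneg fun e he =>
    realBond_nonneg Δ (G.not_isDiag_of_mem_edgeSet (by simpa using he)) h

theorem boltzmann_eq_map (G : SimpleGraph V) (Δ β : ℝ) :
    boltzmann G Δ β = (NormedSpace.exp (β • negHamiltonian G Δ)).map Complex.ofReal := by
  open scoped Matrix.Norms.Operator in
  have h := NormedSpace.map_exp (Complex.ofRealHom.mapMatrix (m := V → Fin 2))
    (continuous_id.matrix_map Complex.continuous_ofReal) (β • negHamiltonian G Δ)
  refine Eq.trans ?_ h.symm
  rw [boltzmann]
  congr 1
  have : hamiltonian G Δ = -(negHamiltonian G Δ).map Complex.ofReal := by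
    rw [map_negHamiltonian, neg_neg]
  rw [this]
  ext σ ρ
  simp

/-- The index in `V → Fin 2` of the basis vector that belongs to `τ`. -/
def configIndex (τ : V → ℤˣ) : V → Fin 2 := fun i => if τ i = 1 then 0 else 1

theorem gibbs_rankOneProj (G : SimpleGraph V) (Δ β : ℝ) (τ : V → ℤˣ) :
    gibbs G Δ β (rankOneProj τ) =
      ((NormedSpace.exp (β • negHamiltonian G Δ) (configIndex τ) (configIndex τ) /
        (NormedSpace.exp (β • negHamiltonian G Δ)).trace : ℝ) : ℂ) := by
  rw [gibbs, partitionFunction, boltzmann_eq_map, Complex.ofReal_div]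
  congr 1
  · have : rankOneProj τ = Matrix.single (configIndex τ) (configIndex τ) 1 := by
      ext σ ρ
      simp [rankOneProj, Matrix.vecMulVec_apply, basisVec, Matrix.single_apply, Pi.single_apply,
        configIndex, funext_iff, eq_comm, ite_and]
      split_ifs <;> rfl
    rw [this, Matrix.trace_single_mul]
    simp
  · simp [Matrix.trace]

end General

/-! ### Exponentials of real symmetric matrices -/

section MatrixExp

variable {n : Type*} [Fintype n] [DecidableEq n]

theorem exp_apply_nonneg_of_nonneg {A : Matrix n n ℝ} (hA : ∀ i j, 0 ≤ A i j) (i j : n) :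
    0 ≤ NormedSpace.exp A i j := by
  have hpow : ∀ k : ℕ, ∀ i j, 0 ≤ (A ^ k) i j := by
    intro k
    induction k with
    | zero => intro i j; rw [pow_zero, Matrix.one_apply]; positivity
    | succ k ih =>
      intro i j
      rw [pow_succ, Matrix.mul_apply]
      exact Finset.sum_nonneg fun l _ => mul_nonneg (ih i l) (hA l j)
  open scoped Matrix.Norms.Operator in
  have h := NormedSpace.exp_series_hasSum_exp' (𝕂 := ℝ) A
  have h2 := (Pi.hasSum.1 (Pi.hasSum.1 h i)) j
  exact h2.nonneg fun k => mul_nonneg (by positivity) (hpow k i j)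

/-- The exponential of a matrix with nonnegative off-diagonal entries is entrywise nonnegative. -/
theorem exp_apply_nonneg {A : Matrix n n ℝ} (hA : ∀ i j, i ≠ j → 0 ≤ A i j) (i j : n) :
    0 ≤ NormedSpace.exp A i j := by
  obtain ⟨c, hc⟩ := Finite.exists_le fun i => -A i i
  -- Adding a multiple of the identity makes the diagonal nonnegative too.
  have hsplit : A = (A + Matrix.diagonal fun _ => c) + Matrix.diagonal fun _ => -c := by
    rw [add_assoc, Matrix.diagonal_add]
    simp
  have hcomm : Commute (A + Matrix.diagonal fun _ => c) (Matrix.diagonal fun _ => -c) :=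
    (Matrix.scalar_commute (-c) (fun r => mul_comm _ _) _).symm
  rw [hsplit, Matrix.exp_add_of_commute _ _ hcomm, Matrix.exp_diagonal, Matrix.mul_diagonal]
  refine mul_nonneg (exp_apply_nonneg_of_nonneg (fun i j => ?_) i j) ?_
  · by_cases h : i = j
    · subst h
      simpa using by linarith [hc i]
    · simpa [Matrix.diagonal_apply_ne _ h] using hA i j h
  · rw [Pi.coe_exp, ← Real.exp_eq_exp_ℝ]
    positivity

theorem hasDerivAt_exp_smul_apply (A : Matrix n n ℝ) (t : ℝ) (i j : n) :
    HasDerivAt (fun u : ℝ => NormedSpace.exp (u • A) i j)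
      ((A * NormedSpace.exp (t • A)) i j) t := by
  open scoped Matrix.Norms.Operator in
  have h := hasDerivAt_exp_smul_const' (𝕂 := ℝ) A t
  exact hasDerivAt_pi.1 (hasDerivAt_pi.1 h i) j

/-- Spectral decomposition of the semigroup of a real symmetric matrix. -/
theorem exists_spectral {A : Matrix n n ℝ} (hA : A.IsHermitian) :
    ∃ (U : Matrix n n ℝ) (ev : n → ℝ), U * U.transpose = 1 ∧ U.transpose * U = 1 ∧
      A = U * Matrix.diagonal ev * U.transpose ∧
      ∀ t : ℝ, NormedSpace.exp (t • A) =
        U * Matrix.diagonal (fun k => Real.exp (t * ev k)) * U.transpose := by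
  have hU := hA.eigenvectorUnitary.2
  set U : Matrix n n ℝ := hA.eigenvectorUnitary.1
  have hstar : star U = U.transpose := Matrix.conjTranspose_eq_transpose_of_trivial U
  have h1 : U * U.transpose = 1 := hstar ▸ Matrix.mem_unitaryGroup_iff.1 hU
  have h2 : U.transpose * U = 1 := hstar ▸ Matrix.mem_unitaryGroup_iff'.1 hU
  have hspec : A = U * Matrix.diagonal hA.eigenvalues * U.transpose := by
    rw [← hstar]
    have h := hA.spectral_theorem
    rw [Unitary.conjStarAlgAut_apply] at h
    exact h
  refine ⟨U, hA.eigenvalues, h1, h2, hspec, fun t => ?_⟩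
  have hinv : U⁻¹ = U.transpose := Matrix.inv_eq_right_inv h1
  have hunit : IsUnit U := IsUnit.of_mul_eq_one _ h1
  have ht : t • A = U * Matrix.diagonal (t • hA.eigenvalues) * U⁻¹ := by
    rw [hinv, Matrix.diagonal_smul, Matrix.mul_smul, Matrix.smul_mul, ← hspec]
  rw [ht, Matrix.exp_conj _ _ hunit, Matrix.exp_diagonal, hinv]
  congr 3
  funext k
  rw [Pi.coe_exp, ← Real.exp_eq_exp_ℝ]
  rfl

/-- A diagonal matrix element of the normalized semigroup, compared with the unnormalized one at an
earlier time. The number `m` is a lower bound on the largest eigenvalue, certified by the test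
vector `1`. -/
theorem exp_apply_div_trace_le {A : Matrix n n ℝ} (hA : A.IsHermitian) {m : ℝ}
    (hm : m * Fintype.card n ≤ ∑ i, ∑ j, A i j) (i : n) {s t : ℝ} (hs : 0 ≤ s) (hst : s ≤ t) :
    NormedSpace.exp (t • A) i i / (NormedSpace.exp (t • A)).trace ≤
      Real.exp (-s * m) * NormedSpace.exp (s • A) i i := by
  obtain ⟨U, ev, h1, h2, hspec, hexp⟩ := exists_spectral hA
  have hentry : ∀ (f : n → ℝ) (a b : n), (U * Matrix.diagonal f * U.transpose) a b =
      ∑ k, f k * (U a k * U b k) := by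
    intro f a b
    simp only [Matrix.mul_apply (M := U * Matrix.diagonal f), Matrix.mul_diagonal,
      Matrix.transpose_apply]
    exact Finset.sum_congr rfl fun k _ => by ring
  have : Nonempty n := ⟨i⟩
  obtain ⟨k₀, hk₀⟩ := Finite.exists_max ev
  have htop : m ≤ ev k₀ := by
    have hswap : ∀ f : n → ℝ, ∑ a, ∑ b, ∑ k, f k * (U a k * U b k) =
        ∑ k, f k * (∑ a, U a k) ^ 2 := by
      intro f
      simp_rw [sq, Finset.sum_mul_sum, Finset.mul_sum]
      rw [Finset.sum_congr rfl fun a _ => Finset.sum_comm, Finset.sum_comm]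
    have hone : ∑ k, (1 : ℝ) * (∑ a, U a k) ^ 2 = Fintype.card n := by
      rw [← hswap]
      simp_rw [← hentry, Matrix.diagonal_one, Matrix.mul_one, h1]
      simp [Matrix.one_apply]
    have hA' : ∑ a, ∑ b, A a b = ∑ k, ev k * (∑ a, U a k) ^ 2 := by
      rw [← hswap]
      simp_rw [← hentry]
      rw [← hspec]
    have hle : ∑ k, ev k * (∑ a, U a k) ^ 2 ≤ ev k₀ * Fintype.card n := by
      rw [← hone, Finset.mul_sum]
      exact Finset.sum_le_sum fun k _ => by
        rw [one_mul]; exact mul_le_mul_of_nonneg_right (hk₀ k) (sq_nonneg _)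
    have hpos : (0 : ℝ) < Fintype.card n := by exact_mod_cast Fintype.card_pos
    exact le_of_mul_le_mul_right ((hm.trans hA'.le).trans hle) hpos
  have htrace : Real.exp (t * ev k₀) ≤ (NormedSpace.exp (t • A)).trace := by
    rw [hexp, Matrix.trace_mul_comm, ← Matrix.mul_assoc, h2, Matrix.one_mul, Matrix.trace_diagonal]
    exact Finset.single_le_sum (f := fun k => Real.exp (t * ev k))
      (fun k _ => (Real.exp_pos _).le) (Finset.mem_univ k₀)
  rw [div_le_iff₀ (lt_of_lt_of_le (Real.exp_pos _) htrace)]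
  have hnonneg : 0 ≤ NormedSpace.exp (s • A) i i := by
    rw [hexp, hentry]
    exact Finset.sum_nonneg fun k _ => mul_nonneg (Real.exp_pos _).le (mul_self_nonneg _)
  calc NormedSpace.exp (t • A) i i
      ≤ Real.exp ((t - s) * ev k₀) * NormedSpace.exp (s • A) i i := by
        rw [hexp, hexp, hentry, hentry, Finset.mul_sum]
        refine Finset.sum_le_sum fun k _ => ?_
        rw [← mul_assoc (Real.exp ((t - s) * ev k₀)), ← Real.exp_add]
        refine mul_le_mul_of_nonneg_right (Real.exp_le_exp.2 ?_) (mul_self_nonneg _)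
        nlinarith [hk₀ k]
    _ ≤ Real.exp (-s * m + t * ev k₀) * NormedSpace.exp (s • A) i i := by
        refine mul_le_mul_of_nonneg_right (Real.exp_le_exp.2 ?_) hnonneg
        nlinarith
    _ = Real.exp (-s * m) * NormedSpace.exp (s • A) i i * Real.exp (t * ev k₀) := by
        rw [Real.exp_add]; ring
    _ ≤ _ := mul_le_mul_of_nonneg_left htrace (mul_nonneg (Real.exp_pos _).le hnonneg)

end MatrixExp

/-! ### Propagation in imaginary time -/

section Mismatch

variable {V : Type*} [Fintype V]

/-- The weighted mismatch of the configuration `σ` with the reference configuration `s`: the total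
`w`-weight of the sites where they differ. -/
def mismatch (s : V → Fin 2) (w : V → ℝ) (σ : V → Fin 2) : ℝ :=
  ∑ i, if σ i = s i then 0 else w i

theorem mismatch_self (s : V → Fin 2) (w : V → ℝ) : mismatch s w s = 0 := by
  simp [mismatch]

theorem mismatch_nonneg (s : V → Fin 2) {w : V → ℝ} (hw : ∀ i, 0 ≤ w i) (σ : V → Fin 2) :
    0 ≤ mismatch s w σ :=
  Finset.sum_nonneg fun i _ => by split_ifs <;> simp [hw]

/-- A weight adapted to the configuration `s` on the graph `G`: it vanishes at both ends of each
edge along which `s` changes, and varies by at most `1` along the other edges. -/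
structure IsAdapted (G : SimpleGraph V) (s : V → Fin 2) (w : V → ℝ) : Prop where
  nonneg : ∀ i, 0 ≤ w i
  eq_zero : ∀ i j, G.Adj i j → s i ≠ s j → w i = 0
  lipschitz : ∀ i j, G.Adj i j → s i = s j → |w i - w j| ≤ 1

end Mismatch

section Propagation

variable {V : Type*} [Fintype V] [DecidableEq V]

/-- Half of the configurations are antiparallel on a given edge, so the all-ones vector, a product
state with every spin in the `x` direction, has energy `-1/4` per edge whatever `Δ` is. -/
theorem sum_sum_realBond (Δ : ℝ) {e : Sym2 V} (he : ¬ e.IsDiag) :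
    ∑ σ, ∑ ρ, realBond Δ e σ ρ = 1 / 4 * Fintype.card (V → Fin 2) := by
  induction e with | _ i j
  have hij : i ≠ j := by simpa using he
  refine Finset.sum_comm.trans ?_
  have h := sum_mul_realBond Δ hij (fun _ => 1)
  simp only [one_mul, mul_one] at h
  simp_rw [h, Finset.sum_add_distrib]
  -- Flipping the spin at `i` exchanges parallel and antiparallel configurations.
  let flip : (V → Fin 2) → (V → Fin 2) := fun σ => Function.update σ i (Equiv.swap 0 1 (σ i))
  have hflip : Function.Involutive flip := by
    intro σ
    simp [flip]
  have hpair : ∀ ρ : V → Fin 2, (if ρ i = ρ j then (0 : ℝ) else (1 - Δ) / 2) +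
      (if flip ρ i = flip ρ j then (0 : ℝ) else (1 - Δ) / 2) = (1 - Δ) / 2 := by
    intro ρ
    simp only [flip, Function.update_self, Function.update_of_ne hij.symm]
    generalize ρ i = a
    generalize ρ j = b
    fin_cases a <;> fin_cases b <;> simp
  have hsum := Finset.sum_congr (rfl : (Finset.univ : Finset (V → Fin 2)) = _)
    fun ρ _ => hpair ρ
  have hcomp : ∑ ρ, (if flip ρ i = flip ρ j then (0 : ℝ) else (1 - Δ) / 2) =
      ∑ ρ : V → Fin 2, if ρ i = ρ j then (0 : ℝ) else (1 - Δ) / 2 :=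
    Equiv.sum_comp hflip.toPerm fun ρ : V → Fin 2 => if ρ i = ρ j then (0 : ℝ) else (1 - Δ) / 2
  rw [Finset.sum_add_distrib, hcomp] at hsum
  simp only [Finset.sum_const, Finset.card_univ, nsmul_eq_mul] at hsum ⊢
  linarith

open Classical in
theorem sum_sum_negHamiltonian (G : SimpleGraph V) (Δ : ℝ) :
    ∑ σ, ∑ ρ, negHamiltonian G Δ σ ρ = G.edgeFinset.card / 4 * Fintype.card (V → Fin 2) := by
  simp only [negHamiltonian, Matrix.sum_apply]
  rw [Finset.sum_congr rfl fun σ _ => Finset.sum_comm, Finset.sum_comm,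
    Finset.sum_congr rfl fun e he =>
      sum_sum_realBond Δ (G.not_isDiag_of_mem_edgeSet (by simpa using he))]
  simp only [Finset.sum_const, nsmul_eq_mul]
  ring

/-- Exchanging the spins at the ends of an edge changes the mismatch by at most `1`: along an edge
where `s` is constant the mismatch moves to the neighbour, and along any other edge the weight
vanishes. -/
theorem mismatch_swap_le {G : SimpleGraph V} {s : V → Fin 2} {w : V → ℝ} (hw : IsAdapted G s w)
    {i j : V} (hij : G.Adj i j) {σ : V → Fin 2} (hσ : σ i ≠ σ j) :
    mismatch s w (σ ∘ Equiv.swap i j) ≤ mismatch s w σ + 1 := by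
  rw [← sub_le_iff_le_add', mismatch, mismatch, ← Finset.sum_sub_distrib,
    Fintype.sum_eq_add i j hij.ne fun k hk => by
      simp [Equiv.swap_apply_of_ne_of_ne hk.1 hk.2]]
  simp only [Function.comp_apply, Equiv.swap_apply_left, Equiv.swap_apply_right]
  by_cases hs : s i = s j
  · have hlip := abs_le.1 (hw.lipschitz i j hij hs)
    rw [hs]
    generalize s j = c at *
    generalize σ i = a at *
    generalize σ j = b at *
    fin_cases a <;> fin_cases b <;> fin_cases c <;> simp at hσ ⊢ <;> linarith
  · rw [hw.eq_zero i j hij hs, hw.eq_zero j i hij.symm (Ne.symm hs)]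
    simp

open Classical in
/-- The edges along which the configuration `σ` is antiparallel. -/
noncomputable def antiparallel (G : SimpleGraph V) (σ : V → Fin 2) : Finset (Sym2 V) :=
  G.edgeFinset.filter fun e => ¬ (e.map σ).IsDiag

open Classical in
/-- An antiparallel edge has an end where `σ` differs from `s` or where the weight vanishes, and the
sites of the former kind with `w ≥ r` number at most `mismatch / r`. -/
theorem card_antiparallel_le {G : SimpleGraph V} {s : V → Fin 2} {w : V → ℝ}
    (hw : IsAdapted G s w) {D : ℕ} (hD : ∀ i, G.degree i ≤ D) {r : ℝ} (hr : 0 < r)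
    (σ : V → Fin 2) :
    ((antiparallel G σ).card : ℝ) ≤
      D * (mismatch s w σ / r + (Finset.univ.filter fun i => w i < r).card) := by
  set bad : Finset V := Finset.univ.filter fun i => σ i ≠ s i ∨ w i < r with hbad
  have hsub : antiparallel G σ ⊆ bad.biUnion fun i => G.incidenceFinset i := by
    intro e he
    induction e with | _ i j
    simp only [antiparallel, Finset.mem_filter, SimpleGraph.mem_edgeFinset,
      SimpleGraph.mem_edgeSet, Sym2.map_mk, Sym2.mk_isDiag_iff] at he
    simp only [Finset.mem_biUnion, SimpleGraph.mem_incidenceFinset,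
      SimpleGraph.mk'_mem_incidenceSet_iff, hbad, Finset.mem_filter, Finset.mem_univ, true_and]
    by_cases hs : s i = s j
    · by_cases hi : σ i = s i
      · exact ⟨j, Or.inl fun hj => he.2 (by rw [hi, hj, hs]), he.1, Or.inr rfl⟩
      · exact ⟨i, Or.inl hi, he.1, Or.inl rfl⟩
    · exact ⟨i, Or.inr (by rwa [hw.eq_zero i j he.1 hs]), he.1, Or.inl rfl⟩
  have hcard : (antiparallel G σ).card ≤ bad.card * D :=
    (Finset.card_le_card hsub).trans (Finset.card_biUnion_le_card_mul _ _ _ fun i _ => by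
      rw [SimpleGraph.card_incidenceFinset_eq_degree]; exact hD i)
  have hbadle : (bad.card : ℝ) ≤
      mismatch s w σ / r + (Finset.univ.filter fun i => w i < r).card := by
    rw [mismatch, Finset.sum_div, Finset.card_filter, Finset.card_filter, Nat.cast_sum,
      Nat.cast_sum, ← Finset.sum_add_distrib]
    refine Finset.sum_le_sum fun i _ => ?_
    by_cases h1 : σ i = s i
    · simp [h1]
    · by_cases h2 : w i < r
      · have := div_nonneg (hw.nonneg i) hr.le
        simp [h1, h2, this]
      · simpa [h1, h2] using (one_le_div hr).2 (not_lt.1 h2)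
  calc ((antiparallel G σ).card : ℝ) ≤ bad.card * D := by exact_mod_cast hcard
    _ ≤ _ := by rw [mul_comm]; gcongr

open Classical in
/-- The operator `-H` acting on an exponential of the mismatch. -/
theorem sum_exp_mismatch_mul_negHamiltonian_le {G : SimpleGraph V} {s : V → Fin 2} {w : V → ℝ}
    (hw : IsAdapted G s w) (Δ : ℝ) {θ : ℝ} (hθ : 0 ≤ θ) (hθ1 : θ ≤ 1) (ρ : V → Fin 2) :
    ∑ σ, Real.exp (θ * mismatch s w σ) * negHamiltonian G Δ σ ρ ≤
      (Δ / 4 * G.edgeFinset.card + (Real.exp 1 + |Δ|) / 2 * (antiparallel G ρ).card) *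
        Real.exp (θ * mismatch s w ρ) := by
  have hedge : ∀ e ∈ G.edgeFinset,
      ∑ σ, Real.exp (θ * mismatch s w σ) * realBond Δ e σ ρ ≤
        (Δ / 4 + if (e.map ρ).IsDiag then 0 else (Real.exp 1 + |Δ|) / 2) *
          Real.exp (θ * mismatch s w ρ) := by
    intro e he
    induction e with | _ i j
    have hij : G.Adj i j := by simpa using he
    rw [sum_mul_realBond Δ hij.ne, add_mul]
    refine add_le_add le_rfl ?_
    simp only [Sym2.map_mk, Sym2.mk_isDiag_iff]
    split_ifs with h
    · simp
    · have hswap : Real.exp (θ * mismatch s w (ρ ∘ Equiv.swap i j)) ≤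
          Real.exp 1 * Real.exp (θ * mismatch s w ρ) := by
        rw [← Real.exp_add]
        refine Real.exp_le_exp.2 ?_
        nlinarith [mul_le_mul_of_nonneg_left (mismatch_swap_le hw hij h) hθ]
      have hΔ : -Δ * Real.exp (θ * mismatch s w ρ) ≤ |Δ| * Real.exp (θ * mismatch s w ρ) :=
        mul_le_mul_of_nonneg_right (neg_le_abs Δ) (Real.exp_pos _).le
      linarith
  simp only [negHamiltonian, Matrix.sum_apply, Finset.mul_sum]
  rw [Finset.sum_comm]
  refine (Finset.sum_le_sum hedge).trans (le_of_eq ?_)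
  rw [← Finset.sum_mul, Finset.sum_add_distrib, antiparallel, Finset.sum_ite]
  simp only [Finset.sum_const, nsmul_eq_mul, mul_zero, zero_add]
  ring

open Classical in
/-- Finite speed of propagation in imaginary time: up to a time proportional to `r`, the matrix
element at `s` exceeds its value `exp (t Δ |E| / 4)` for parallel spins only by a factor coming from
the sites of weight less than `r`. With the exponent
`θ t = 1 - t / T` decreasing in time, the loss `θ' * mismatch` pays for the antiparallel edges
created by the mismatch. -/
theorem exp_negHamiltonian_apply_le {G : SimpleGraph V} {s : V → Fin 2} {w : V → ℝ}
    (hw : IsAdapted G s w) (Δ : ℝ) {D : ℕ} (hD : ∀ i, G.degree i ≤ D) {r T : ℝ}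
    (hr : 0 < r) (hT : 0 < T) (hTr : (Real.exp 1 + |Δ|) / 2 * D * T ≤ r) {t : ℝ} (ht : 0 ≤ t)
    (htT : t ≤ T) :
    NormedSpace.exp (t • negHamiltonian G Δ) s s ≤
      Real.exp ((Δ / 4 * G.edgeFinset.card + (Real.exp 1 + |Δ|) / 2 * D *
        (Finset.univ.filter fun i => w i < r).card) * t) := by
  set K : ℝ := (Real.exp 1 + |Δ|) / 2 with hK
  have hK0 : 0 ≤ K := by positivity
  set n : ℝ := ((Finset.univ.filter fun i => w i < r).card : ℝ) with hn
  set E : ℝ := (G.edgeFinset.card : ℝ) with hE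
  set B := negHamiltonian G Δ with hB
  set c : ℝ := Δ / 4 * E + K * D * n with hc
  set φ : (V → Fin 2) → ℝ := mismatch s w
  have hφ : ∀ σ, 0 ≤ φ σ := mismatch_nonneg s hw.nonneg
  let u : ℝ → (V → Fin 2) → ℝ := fun t σ => NormedSpace.exp (t • B) σ s
  have hu : ∀ t, 0 ≤ t → ∀ σ, 0 ≤ u t σ := fun t ht σ =>
    exp_apply_nonneg (fun a b hab => mul_nonneg ht (negHamiltonian_nonneg G Δ hab)) σ s
  -- The exponential moment of the mismatch, divided by the claimed bound on its growth.
  let F : ℝ → ℝ := fun t => ∑ σ, Real.exp ((1 - t / T) * φ σ - c * t) * u t σ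
  let F' : ℝ → ℝ := fun t => ∑ σ, (Real.exp ((1 - t / T) * φ σ - c * t) * (-φ σ / T - c) * u t σ +
    Real.exp ((1 - t / T) * φ σ - c * t) * ∑ ρ, B σ ρ * u t ρ)
  have hF : ∀ t, HasDerivAt F (F' t) t := by
    intro t
    refine HasDerivAt.fun_sum fun σ _ => HasDerivAt.mul ?_ ?_
    · refine HasDerivAt.exp ?_
      have h1 := (((hasDerivAt_id t).div_const T).const_sub 1).mul_const (φ σ)
      have h2 := h1.sub ((hasDerivAt_id t).const_mul c)
      refine h2.congr_deriv ?_
      ring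
    · have h := hasDerivAt_exp_smul_apply B t σ s
      rwa [Matrix.mul_apply] at h
  have hF'le : ∀ t, 0 ≤ t → t ≤ T → F' t ≤ 0 := by
    intro t ht htT
    have hθ : 0 ≤ 1 - t / T := by rw [sub_nonneg, div_le_one hT]; exact htT
    have hθ1 : 1 - t / T ≤ 1 := by have := div_nonneg ht hT.le; linarith
    have hrew : F' t = Real.exp (-(c * t)) * ∑ ρ, u t ρ *
        (Real.exp ((1 - t / T) * φ ρ) * (-φ ρ / T - c) +
          ∑ σ, Real.exp ((1 - t / T) * φ σ) * B σ ρ) := by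
      simp only [F', sub_eq_add_neg _ (c * t), Real.exp_add, Finset.sum_add_distrib, mul_add,
        Finset.mul_sum]
      congr 1
      · exact Finset.sum_congr rfl fun σ _ => by ring
      · rw [Finset.sum_comm]
        exact Finset.sum_congr rfl fun ρ _ => Finset.sum_congr rfl fun σ _ => by ring
    rw [hrew]
    refine mul_nonpos_of_nonneg_of_nonpos (Real.exp_pos _).le (Finset.sum_nonpos fun ρ _ =>
      mul_nonpos_of_nonneg_of_nonpos (hu t ht ρ) ?_)
    have h1 : ∑ σ, Real.exp ((1 - t / T) * φ σ) * B σ ρ ≤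
        (Δ / 4 * E + K * (antiparallel G ρ).card) * Real.exp ((1 - t / T) * φ ρ) :=
      sum_exp_mismatch_mul_negHamiltonian_le hw Δ hθ hθ1 ρ
    have h2 : K * (antiparallel G ρ).card ≤ φ ρ / T + K * D * n := by
      have h3 := mul_le_mul_of_nonneg_left (card_antiparallel_le hw hD hr ρ) hK0
      have h4 : K * D * (φ ρ / r) ≤ φ ρ / T := by
        rw [← mul_div_assoc, div_le_div_iff₀ hr hT]
        nlinarith [hφ ρ, mul_le_mul_of_nonneg_left hTr (hφ ρ)]
      calc _ ≤ _ := h3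
        _ = K * D * (φ ρ / r) + K * D * n := by ring
        _ ≤ _ := by linarith
    have h5 : Δ / 4 * E + K * (antiparallel G ρ).card ≤ φ ρ / T + c := by linarith
    have h6 := mul_le_mul_of_nonneg_right h5 (Real.exp_pos ((1 - t / T) * φ ρ)).le
    have h7 : -φ ρ / T = -(φ ρ / T) := neg_div _ _
    rw [h7]
    linarith
  have hanti : AntitoneOn F (Set.Icc 0 T) := by
    refine antitoneOn_of_deriv_nonpos (convex_Icc 0 T)
      (fun t _ => (hF t).continuousAt.continuousWithinAt)
      (fun t _ => (hF t).differentiableAt.differentiableWithinAt) fun t ht => ?_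
    rw [interior_Icc] at ht
    rw [(hF t).deriv]
    exact hF'le t ht.1.le ht.2.le
  have hF0 : F 0 = 1 := by
    simp only [F, u]
    rw [Finset.sum_eq_single s]
    · simp [φ, mismatch_self]
    · intro σ _ hσ
      simp [hσ]
    · simp
  have hFt : F t ≤ 1 := hF0 ▸ hanti ⟨le_rfl, hT.le⟩ ⟨ht, htT⟩ ht
  have hsingle : Real.exp (-(c * t)) * u t s ≤ F t := by
    have h := Finset.single_le_sum
      (f := fun σ => Real.exp ((1 - t / T) * φ σ - c * t) * u t σ)
      (fun σ _ => mul_nonneg (Real.exp_pos _).le (hu t ht σ)) (Finset.mem_univ s)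
    simpa [φ, mismatch_self] using h
  rw [Real.exp_neg, inv_mul_le_iff₀ (Real.exp_pos _)] at hsingle
  calc u t s ≤ Real.exp (c * t) * F t := hsingle
    _ ≤ Real.exp (c * t) * 1 := by gcongr
    _ = _ := mul_one _

open Classical in
/-- The normalized weight of the configuration `s` is exponentially small in the number of edges,
up to the contribution of the sites of weight less than `r`. -/
theorem exp_negHamiltonian_div_trace_le {G : SimpleGraph V} {s : V → Fin 2} {w : V → ℝ}
    (hw : IsAdapted G s w) (Δ : ℝ) {D : ℕ} (hD : ∀ i, G.degree i ≤ D) {r T : ℝ}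
    (hr : 0 < r) (hT : 0 < T) (hTr : (Real.exp 1 + |Δ|) / 2 * D * T ≤ r) {β : ℝ} (hβ : 0 ≤ β) :
    NormedSpace.exp (β • negHamiltonian G Δ) s s /
        (NormedSpace.exp (β • negHamiltonian G Δ)).trace ≤
      Real.exp (-((1 - Δ) / 4 * G.edgeFinset.card - (Real.exp 1 + |Δ|) / 2 * D *
        (Finset.univ.filter fun i => w i < r).card) * min T β) := by
  have h1 := exp_apply_div_trace_le (negHamiltonian_isHermitian G Δ)
    (sum_sum_negHamiltonian G Δ).ge s (le_min hT.le hβ) (min_le_right T β)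
  have h2 := exp_negHamiltonian_apply_le hw Δ hD hr hT hTr (le_min hT.le hβ) (min_le_left T β)
  refine (h1.trans (mul_le_mul_of_nonneg_left h2 (Real.exp_pos _).le)).trans (le_of_eq ?_)
  rw [← Real.exp_add]
  congr 1
  ring

end Propagation

/-! ### The torus and its blocks -/

section Torus

/-- The block `⌊(2x - 1) / (2L)⌋` of a coordinate `x`, as an integer quotient. -/
theorem floor_block (x : ℤ) {L : ℕ} (hL : 0 < L) :
    ⌊(2 * (x : ℚ) - 1) / (2 * (L : ℚ))⌋ = (x - 1) / L := by
  have hL' : (0 : ℤ) < L := by exact_mod_cast hL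
  have hLq : (0 : ℚ) < L := by exact_mod_cast hL
  have h1 := Int.emod_add_mul_ediv (x - 1) L
  have h2 := Int.emod_nonneg (x - 1) hL'.ne'
  have h3 := Int.emod_lt_of_pos (x - 1) hL'
  set q := (x - 1) / (L : ℤ)
  set m := (x - 1) % (L : ℤ)
  have h1q : (m : ℚ) + L * q = x - 1 := by exact_mod_cast h1
  have h2q : (0 : ℚ) ≤ m := by exact_mod_cast h2
  have h3q : (m : ℚ) + 1 ≤ L := by exact_mod_cast h3
  rw [Int.floor_eq_iff, le_div_iff₀ (by positivity), div_lt_iff₀ (by positivity)]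
  constructor <;> nlinarith

/-- Distance of a coordinate `x ∈ {-M + 1, …, M}` to the ends of its block and to the two ends of
the interval, which are neighbours on the torus. -/
def blockDist (M L : ℕ) (x : ℤ) : ℤ :=
  min (min ((x - 1) % L) (L - 1 - (x - 1) % L)) (min (M - x) (x + M - 1))

theorem blockDist_nonneg {M L : ℕ} (hL : 0 < L) {x : ℤ} (hx : x ∈ Finset.Icc (-(M : ℤ) + 1) M) :
    0 ≤ blockDist M L x := by
  have hL' : (0 : ℤ) < L := by exact_mod_cast hL
  have h2 := Int.emod_nonneg (x - 1) hL'.ne'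
  have h3 := Int.emod_lt_of_pos (x - 1) hL'
  rw [Finset.mem_Icc] at hx
  simp only [blockDist, le_min_iff]
  omega

/-- Two consecutive coordinates lie in the same block, or are the end of one block and the start
of the next one. -/
theorem block_succ (M : ℕ) {L : ℕ} (hL : 0 < L) {x : ℤ} (hx : -(M : ℤ) + 1 ≤ x)
    (hx' : x + 1 ≤ M) :
    |blockDist M L x - blockDist M L (x + 1)| ≤ 1 ∧
      ((x - 1) / (L : ℤ) = (x + 1 - 1) / L ∨
        (blockDist M L x = 0 ∧ blockDist M L (x + 1) = 0)) := by
  have hL' : (0 : ℤ) < L := by exact_mod_cast hL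
  have h1 := Int.emod_add_mul_ediv (x - 1) L
  have h2 := Int.emod_nonneg (x - 1) hL'.ne'
  have h3 := Int.emod_lt_of_pos (x - 1) hL'
  simp only [blockDist]
  set q := (x - 1) / (L : ℤ)
  set m := (x - 1) % (L : ℤ)
  by_cases hm : m + 1 < L
  · have hq : (x + 1 - 1) / (L : ℤ) = q ∧ (x + 1 - 1) % (L : ℤ) = m + 1 := by
      rw [Int.ediv_emod_unique hL']
      exact ⟨by linarith, by omega, hm⟩
    rw [hq.1, hq.2, abs_le]
    omega
  · have hq : (x + 1 - 1) / (L : ℤ) = q + 1 ∧ (x + 1 - 1) % (L : ℤ) = 0 := by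
      rw [Int.ediv_emod_unique hL']
      exact ⟨by nlinarith, le_rfl, hL'⟩
    rw [hq.2, abs_le]
    omega

theorem box_even (d M : ℕ) :
    box d (2 * M) = Fintype.piFinset fun _ => Finset.Icc (-(M : ℤ) + 1) M := by
  have h : ((2 * M : ℕ) : ℚ) / 2 = M := by push_cast; ring
  rw [box, h, Int.ceil_natCast, Int.floor_natCast]

theorem mem_box_even {d M : ℕ} {x : Fin d → ℤ} :
    x ∈ box d (2 * M) ↔ ∀ k, x k ∈ Finset.Icc (-(M : ℤ) + 1) M := by
  rw [box_even, Fintype.mem_piFinset]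

theorem mem_Icc_of_box {d M : ℕ} (i : box d (2 * M)) (k : Fin d) :
    (i : Fin d → ℤ) k ∈ Finset.Icc (-(M : ℤ) + 1) M :=
  mem_box_even.1 i.2 k

theorem card_box (d M : ℕ) : Fintype.card (box d (2 * M)) = (2 * M) ^ d := by
  rw [Fintype.card_coe, box_even, Fintype.card_piFinset]
  simp only [Int.card_Icc, Finset.prod_const, Finset.card_univ, Fintype.card_fin]
  congr 1
  omega

/-- The edges of the torus: the two ends agree in all coordinates but one, where they are
consecutive, or the two ends of the interval. -/
theorem exists_of_torus_adj {d M L : ℕ} (hL : 0 < L) {i j : box d (2 * M)}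
    (h : (torus d (2 * M)).Adj i j) :
    ∃ k : Fin d, (∀ l, l ≠ k → (i : Fin d → ℤ) l = (j : Fin d → ℤ) l) ∧
      |blockDist M L ((i : Fin d → ℤ) k) - blockDist M L ((j : Fin d → ℤ) k)| ≤ 1 ∧
      (((i : Fin d → ℤ) k - 1) / (L : ℤ) = ((j : Fin d → ℤ) k - 1) / L ∨
        (blockDist M L ((i : Fin d → ℤ) k) = 0 ∧ blockDist M L ((j : Fin d → ℤ) k) = 0)) := by
  rw [torus, SimpleGraph.fromRel_adj] at h
  have key : ∀ i j : box d (2 * M), (∃ k : Fin d,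
      (j : Fin d → ℤ) - (i : Fin d → ℤ) = Pi.single k 1 ∨
      (j : Fin d → ℤ) - (i : Fin d → ℤ) = Pi.single k (-(((2 * M : ℕ) : ℤ) - 1))) →
    ∃ k : Fin d, (∀ l, l ≠ k → (i : Fin d → ℤ) l = (j : Fin d → ℤ) l) ∧
      |blockDist M L ((i : Fin d → ℤ) k) - blockDist M L ((j : Fin d → ℤ) k)| ≤ 1 ∧
      (((i : Fin d → ℤ) k - 1) / (L : ℤ) = ((j : Fin d → ℤ) k - 1) / L ∨
        (blockDist M L ((i : Fin d → ℤ) k) = 0 ∧ blockDist M L ((j : Fin d → ℤ) k) = 0)) := by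
    rintro i j ⟨k, hk⟩
    have hi := mem_Icc_of_box i k
    have hj := mem_Icc_of_box j k
    refine ⟨k, fun l hl => ?_, ?_⟩
    · rcases hk with hk | hk <;>
      · have := congrFun hk l
        simp only [Pi.sub_apply, Pi.single_eq_of_ne hl] at this
        omega
    · rcases hk with hk | hk
      · have := congrFun hk k
        simp only [Pi.sub_apply, Pi.single_eq_same] at this
        have hjk : (j : Fin d → ℤ) k = (i : Fin d → ℤ) k + 1 := by omega
        rw [Finset.mem_Icc] at hi hj
        rw [hjk]
        exact block_succ M hL hi.1 (by omega)
      · have := congrFun hk k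
        simp only [Pi.sub_apply, Pi.single_eq_same] at this
        have h1 := blockDist_nonneg hL hi
        have h2 := blockDist_nonneg hL hj
        rw [Finset.mem_Icc] at hi hj
        have h3 : blockDist M L ((i : Fin d → ℤ) k) ≤ M - (i : Fin d → ℤ) k :=
          (min_le_right _ _).trans (min_le_left _ _)
        have h4 : blockDist M L ((j : Fin d → ℤ) k) ≤ (j : Fin d → ℤ) k + M - 1 :=
          (min_le_right _ _).trans (min_le_right _ _)
        push_cast at this
        have h5 : blockDist M L ((i : Fin d → ℤ) k) = 0 := by omega
        have h6 : blockDist M L ((j : Fin d → ℤ) k) = 0 := by omega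
        exact ⟨by simp [h5, h6], Or.inr ⟨h5, h6⟩⟩
  rcases h.2 with h | h
  · exact key i j h
  · obtain ⟨k, h1, h2, h3⟩ := key j i h
    exact ⟨k, fun l hl => (h1 l hl).symm, by rwa [abs_sub_comm], h3.imp Eq.symm And.symm⟩

/-- The weight of a site: the least distance of a coordinate to the ends of its block and of the
interval. -/
noncomputable def siteWeight (d M L : ℕ) [NeZero d] (i : box d (2 * M)) : ℤ :=
  Finset.univ.inf' Finset.univ_nonempty fun k => blockDist M L ((i : Fin d → ℤ) k)

theorem isAdapted_siteWeight (d M : ℕ) [NeZero d] {L : ℕ} (hL : 0 < L) :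
    IsAdapted (torus d (2 * M)) (configIndex (blockConfig d (2 * M) L))
      (fun i => (siteWeight d M L i : ℝ)) := by
  have hnonneg : ∀ i, 0 ≤ siteWeight d M L i := fun i =>
    Finset.le_inf' _ _ fun k _ => blockDist_nonneg hL (mem_Icc_of_box i k)
  have hle : ∀ i k, siteWeight d M L i ≤ blockDist M L ((i : Fin d → ℤ) k) := fun i k =>
    Finset.inf'_le (fun k => blockDist M L ((i : Fin d → ℤ) k)) (Finset.mem_univ k)
  refine ⟨fun i => by exact_mod_cast hnonneg i, fun i j hij hs => ?_, fun i j hij _ => ?_⟩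
  · obtain ⟨k, h1, -, h3 | h3⟩ := exists_of_torus_adj hL hij
    · refine absurd ?_ hs
      simp only [configIndex, blockConfig, floor_block _ hL]
      have : ∀ l, ((i : Fin d → ℤ) l - 1) / (L : ℤ) = ((j : Fin d → ℤ) l - 1) / L := by
        intro l
        by_cases hl : l = k
        · rw [hl, h3]
        · rw [h1 l hl]
      simp only [this]
    · exact_mod_cast le_antisymm (h3.1 ▸ hle i k) (hnonneg i)
  · have key : ∀ i j, (torus d (2 * M)).Adj i j → siteWeight d M L i ≤ siteWeight d M L j + 1 := by
      intro i j hij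
      obtain ⟨k, h1, h2, -⟩ := exists_of_torus_adj hL hij
      rw [← sub_le_iff_le_add]
      refine Finset.le_inf' _ _ fun l _ => ?_
      have h4 := hle i l
      by_cases hl : l = k
      · subst hl
        have := (abs_le.1 h2).2
        linarith
      · rw [← h1 l hl]
        linarith
    rw [abs_le]
    have h1 := key i j hij
    have h2 := key j i hij.symm
    constructor
    · have : (siteWeight d M L j : ℝ) ≤ siteWeight d M L i + 1 := by exact_mod_cast h2
      linarith
    · have : (siteWeight d M L i : ℝ) ≤ siteWeight d M L j + 1 := by exact_mod_cast h1
      linarith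

/-- A residue class modulo `L` has at most `2 M / L + 1` elements in the interval. -/
theorem card_residue_le (M : ℕ) {L : ℕ} (hL : 0 < L) (v : ℤ) :
    (((Finset.Icc (-(M : ℤ) + 1) M).filter fun x => x ≡ v [ZMOD L]).card : ℝ) ≤
      2 * M / L + 1 := by
  have hL' : (0 : ℤ) < L := by exact_mod_cast hL
  have hIcc : Finset.Icc (-(M : ℤ) + 1) M = Finset.Ioc (-(M : ℤ)) M := by
    ext x
    simp only [Finset.mem_Icc, Finset.mem_Ioc]
    omega
  have h := Int.Ioc_filter_modEq_card (-(M : ℤ)) M hL' v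
  rw [hIcc]
  have hq : (((Finset.Ioc (-(M : ℤ)) M).filter fun x => x ≡ v [ZMOD L]).card : ℚ) ≤
      2 * M / L + 1 := by
    have h' : (((Finset.Ioc (-(M : ℤ)) M).filter fun x => x ≡ v [ZMOD L]).card : ℚ) =
        ((max (⌊(((M : ℤ) : ℚ) - v) / ((L : ℤ) : ℚ)⌋ -
          ⌊(((-(M : ℤ) : ℤ) : ℚ) - v) / ((L : ℤ) : ℚ)⌋) 0 : ℤ) : ℚ) := by
      rw [← h]; norm_cast
    rw [h']
    push_cast
    have h1 := Int.floor_le (((M : ℚ) - v) / L)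
    have h2 := Int.lt_floor_add_one ((-(M : ℚ) - v) / L)
    have h3 : ((M : ℚ) - v) / L - (-(M : ℚ) - v) / L = 2 * M / L := by ring
    refine max_le (by linarith) (by positivity)
  have hr := (Rat.cast_le (K := ℝ)).2 hq
  push_cast at hr
  exact hr

/-- Few coordinates of the interval are within distance `R` of the ends of their block. -/
theorem card_blockDist_lt_le {M L R : ℕ} (hL : 0 < L) (hLM : L ≤ 2 * M) :
    (((Finset.Icc (-(M : ℤ) + 1) M).filter fun x => blockDist M L x < R).card : ℝ) ≤
      R * (6 * (2 * M / L)) := by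
  set I := Finset.Icc (-(M : ℤ) + 1) M with hI
  let S : ℕ → Finset ℤ := fun y => (I.filter fun x => x ≡ y + 1 [ZMOD L]) ∪
    (I.filter fun x => x ≡ -y [ZMOD L]) ∪ {(M : ℤ) - y, -(M : ℤ) + 1 + y}
  have hLpos : (0 : ℤ) < L := by exact_mod_cast hL
  have hsub : I.filter (fun x => blockDist M L x < R) ⊆ (Finset.range R).biUnion S := by
    intro x hx
    rw [Finset.mem_filter] at hx
    obtain ⟨hxI, hx⟩ := hx
    have hd := blockDist_nonneg hL hxI
    have h2 := Int.emod_nonneg (x - 1) hLpos.ne'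
    have h3 := Int.emod_lt_of_pos (x - 1) hLpos
    have hmem := Finset.mem_Icc.1 hxI
    have hmod : x - 1 ≡ (x - 1) % L [ZMOD L] := (Int.mod_modEq _ _).symm
    rw [Finset.mem_biUnion]
    simp only [blockDist, min_lt_iff] at hx
    simp only [S, Finset.mem_union, Finset.mem_filter, Finset.mem_insert, Finset.mem_singleton,
      hxI, true_and, Finset.mem_range]
    rcases hx with (hx | hx) | (hx | hx)
    · refine ⟨((x - 1) % L).toNat, by omega, Or.inl (Or.inl ?_)⟩
      rw [Int.toNat_of_nonneg h2]
      simpa using hmod.add_right 1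
    · refine ⟨(L - 1 - (x - 1) % L).toNat, by omega, Or.inl (Or.inr ?_)⟩
      rw [Int.toNat_of_nonneg (by omega)]
      have h4 : x ≡ (x - 1) % L + 1 [ZMOD L] := by simpa using hmod.add_right 1
      refine h4.trans (Int.modEq_iff_dvd.2 ⟨-1, by ring⟩)
    · exact ⟨(M - x).toNat, by omega, Or.inr (Or.inl (by omega))⟩
    · exact ⟨(x + M - 1).toNat, by omega, Or.inr (Or.inr (by omega))⟩
  have hone : (1 : ℝ) ≤ 2 * M / L := by
    rw [one_le_div (by exact_mod_cast hL)]
    exact_mod_cast hLM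
  have hS : ∀ y, ((S y).card : ℝ) ≤ 6 * (2 * M / L) := by
    intro y
    have h1 := card_residue_le M hL (y + 1)
    have h2 := card_residue_le M hL (-y)
    have h3 : (({(M : ℤ) - y, -(M : ℤ) + 1 + y} : Finset ℤ).card : ℝ) ≤ 2 := by
      exact_mod_cast Finset.card_le_two
    have h4 : (S y).card ≤ (I.filter fun x => x ≡ y + 1 [ZMOD L]).card +
        (I.filter fun x => x ≡ -y [ZMOD L]).card +
        ({(M : ℤ) - y, -(M : ℤ) + 1 + y} : Finset ℤ).card :=
      (Finset.card_union_le _ _).trans (Nat.add_le_add_right (Finset.card_union_le _ _) _)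
    have h5 := (Nat.cast_le (α := ℝ)).2 h4
    rw [Nat.cast_add, Nat.cast_add] at h5
    linarith
  calc _ ≤ (((Finset.range R).biUnion S).card : ℝ) := by exact_mod_cast Finset.card_le_card hsub
    _ ≤ ∑ y ∈ Finset.range R, ((S y).card : ℝ) := by exact_mod_cast Finset.card_biUnion_le
    _ ≤ ∑ _y ∈ Finset.range R, (6 * (2 * M / L) : ℝ) := Finset.sum_le_sum fun y _ => hS y
    _ = _ := by simp

/-- Few sites are within distance `R` of the ends of their block. -/
theorem card_siteWeight_lt_le (d M : ℕ) [NeZero d] {L R : ℕ} (hL : 0 < L) (hLM : L ≤ 2 * M) :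
    ((Finset.univ.filter fun i : box d (2 * M) => siteWeight d M L i < R).card : ℝ) ≤
      6 * d * (R / L) * (2 * M : ℝ) ^ d := by
  set I := Finset.Icc (-(M : ℤ) + 1) M with hI
  set J := I.filter fun x => blockDist M L x < R with hJ
  let P : Fin d → Finset (Fin d → ℤ) := fun k =>
    Fintype.piFinset (Function.update (fun _ => I) k J)
  have hIcard : I.card = 2 * M := by
    rw [hI, Int.card_Icc]
    omega
  have hP : ∀ k, ((P k).card : ℝ) ≤ 6 * (R / L) * (2 * M : ℝ) ^ d := by
    intro k
    have hcard : (P k).card = J.card * (2 * M) ^ (d - 1) := by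
      rw [Fintype.card_piFinset, ← Finset.mul_prod_erase _ _ (Finset.mem_univ k),
        Function.update_self]
      congr 1
      rw [Finset.prod_congr rfl fun l hl => by
        rw [Function.update_of_ne (Finset.ne_of_mem_erase hl), hIcard]]
      simp
    have hd : (2 * M : ℝ) ^ d = (2 * M : ℝ) ^ (d - 1) * (2 * M) := by
      rw [← pow_succ, Nat.sub_add_cancel (NeZero.one_le)]
    rw [hcard, hd]
    push_cast
    have h := mul_le_mul_of_nonneg_right (card_blockDist_lt_le (R := R) hL hLM)
      (by positivity : (0 : ℝ) ≤ (2 * M : ℝ) ^ (d - 1))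
    refine h.trans (le_of_eq ?_)
    ring
  have hsub : (Finset.univ.filter fun i : box d (2 * M) => siteWeight d M L i < R).image
      Subtype.val ⊆ Finset.univ.biUnion P := by
    intro x hx
    simp only [Finset.mem_image, Finset.mem_filter, Finset.mem_univ, true_and] at hx
    obtain ⟨i, hi, rfl⟩ := hx
    rw [siteWeight, Finset.inf'_lt_iff] at hi
    obtain ⟨k, -, hk⟩ := hi
    refine Finset.mem_biUnion.2 ⟨k, Finset.mem_univ k, Fintype.mem_piFinset.2 fun l => ?_⟩
    by_cases hl : l = k
    · subst hl
      rw [Function.update_self]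
      exact Finset.mem_filter.2 ⟨mem_Icc_of_box i l, hk⟩
    · rw [Function.update_of_ne hl]
      exact mem_Icc_of_box i l
  rw [← Finset.card_image_of_injective _ Subtype.val_injective]
  calc _ ≤ ((Finset.univ.biUnion P).card : ℝ) := by exact_mod_cast Finset.card_le_card hsub
    _ ≤ ∑ k, ((P k).card : ℝ) := by exact_mod_cast Finset.card_biUnion_le
    _ ≤ ∑ _k : Fin d, 6 * (R / L) * (2 * M : ℝ) ^ d := Finset.sum_le_sum fun k _ => hP k
    _ = _ := by simp; ring

open Classical in
theorem torus_degree_le (d N : ℕ) (i : box d N) : (torus d N).degree i ≤ 4 * d := by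
  let T : Finset (Fin d → ℤ) := Finset.univ.biUnion fun k : Fin d =>
    {(i : Fin d → ℤ) + Pi.single k 1, (i : Fin d → ℤ) + Pi.single k (-((N : ℤ) - 1)),
      (i : Fin d → ℤ) - Pi.single k 1, (i : Fin d → ℤ) - Pi.single k (-((N : ℤ) - 1))}
  have hsub : ((torus d N).neighborFinset i).image Subtype.val ⊆ T := by
    intro x hx
    simp only [Finset.mem_image, SimpleGraph.mem_neighborFinset] at hx
    obtain ⟨j, hj, rfl⟩ := hx
    rw [torus, SimpleGraph.fromRel_adj] at hj
    simp only [T, Finset.mem_biUnion, Finset.mem_univ, true_and, Finset.mem_insert,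
      Finset.mem_singleton]
    rcases hj.2 with ⟨k, hk | hk⟩ | ⟨k, hk | hk⟩ <;> refine ⟨k, ?_⟩ <;> rw [← hk] <;> simp
  rw [← SimpleGraph.card_neighborFinset_eq_degree,
    ← Finset.card_image_of_injective _ Subtype.val_injective]
  refine (Finset.card_le_card hsub).trans ?_
  refine (Finset.card_biUnion_le_card_mul _ _ 4 fun k _ => Finset.card_le_four).trans ?_
  simp [mul_comm]

open Classical in
/-- Every site has a neighbour, so there is at least one edge for every two sites. -/
theorem card_le_two_mul_card_edgeFinset (d M : ℕ) [NeZero d] (hM : 1 ≤ M) :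
    (2 * M) ^ d ≤ 2 * (torus d (2 * M)).edgeFinset.card := by
  rw [← SimpleGraph.sum_degrees_eq_twice_card_edges, ← card_box d M]
  have hdeg : ∀ i : box d (2 * M), 1 ≤ (torus d (2 * M)).degree i := by
    intro i
    rw [Nat.one_le_iff_ne_zero, ← Nat.pos_iff_ne_zero, SimpleGraph.degree_pos_iff_exists_adj]
    have hi := Finset.mem_Icc.1 (mem_Icc_of_box i 0)
    -- The next site in the direction of the first axis, across the seam if necessary.
    let c : ℤ := if (i : Fin d → ℤ) 0 = M then -(((2 * M : ℕ) : ℤ) - 1) else 1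
    have hc : c ≠ 0 := by
      simp only [c]
      split_ifs
      · push_cast
        omega
      · exact one_ne_zero
    have hmem : (i : Fin d → ℤ) + Pi.single 0 c ∈ box d (2 * M) := by
      refine mem_box_even.2 fun l => ?_
      by_cases hl : l = 0
      · subst hl
        simp only [Pi.add_apply, Pi.single_eq_same, Finset.mem_Icc, c]
        split_ifs <;> push_cast <;> omega
      · simpa [Pi.single_eq_of_ne hl] using mem_Icc_of_box i l
    refine ⟨⟨_, hmem⟩, ?_⟩
    rw [torus, SimpleGraph.fromRel_adj]
    refine ⟨fun h => hc ?_, Or.inl ⟨0, ?_⟩⟩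
    · have := congrFun (congrArg Subtype.val h) 0
      simpa using this
    · simp only [add_sub_cancel_left, c]
      split_ifs
      · exact Or.inr rfl
      · exact Or.inl rfl
  rw [← Finset.card_univ, Finset.card_eq_sum_ones]
  exact Finset.sum_le_sum fun i _ => hdeg i

end Torus

end XXZ

/-! ### The bound on the universal contour -/

theorem mainTheorem4 (d : ℕ) (hd : 1 ≤ d) (Δ : ℝ) (hΔ : Δ < 1) :
    ∃ L₀ : ℕ, 1 ≤ L₀ ∧ ∃ C c : ℝ, 0 < C ∧ 0 < c ∧
      ∀ L N : ℕ, L₀ ≤ L → Even N → 32 * d * L ≤ N → ∀ β : ℝ, 0 ≤ β →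
        (XXZ.gibbs (XXZ.torus d N) Δ β (XXZ.universalContour d N L)).im = 0 ∧
        (XXZ.gibbs (XXZ.torus d N) Δ β (XXZ.universalContour d N L)).re
          ≤ C * Real.exp (-c * (N : ℝ) ^ d * min (L : ℝ) β) := by
  have : NeZero d := ⟨by omega⟩
  have hdpos : (0 : ℝ) < d := by exact_mod_cast hd
  have hgap : 0 < 1 - Δ := sub_pos.2 hΔ
  -- A bound on the growth rate contributed by the edges at a single site, of which there are at
  -- most `4 d`.
  set κ : ℝ := (Real.exp 1 + |Δ|) / 2 * (4 * d : ℕ) with hκ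
  have hκ0 : 0 < κ := by
    rw [hκ]
    push_cast
    positivity
  -- The layer around the block boundaries has width `η L`; at this `η` it uses up at most half of
  -- the energy gap, which is at least `(1 - Δ) / 8` per site.
  set η : ℝ := (1 - Δ) / (192 * d * κ) with hη
  have hη0 : 0 < η := by positivity
  have hηκ : κ * (12 * d * η) = (1 - Δ) / 16 := by
    rw [hη]
    field_simp
    norm_num
  refine ⟨⌈1 / η⌉₊ + 1, by omega, 1, (1 - Δ) / 16 * min (η / κ) 1, one_pos,
    mul_pos (by positivity) (lt_min (by positivity) one_pos), ?_⟩
  intro L N hL hN hLN β hβ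
  obtain ⟨M, rfl⟩ := hN.two_dvd
  have hL1 : 0 < L := by omega
  have hLpos : (0 : ℝ) < L := by exact_mod_cast hL1
  have hLM : L ≤ 2 * M := by nlinarith
  have hηL : 1 ≤ η * L := by
    have h1 : 1 / η ≤ L := (Nat.le_ceil _).trans (by exact_mod_cast (by omega : ⌈1 / η⌉₊ ≤ L))
    rwa [div_le_iff₀' hη0] at h1
  rw [XXZ.universalContour, XXZ.gibbs_rankOneProj]
  refine ⟨Complex.ofReal_im _, ?_⟩
  rw [Complex.ofReal_re, one_mul]
  have hT : 0 < η * L / κ := by positivity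
  classical
  have h := XXZ.exp_negHamiltonian_div_trace_le (XXZ.isAdapted_siteWeight d M hL1) Δ
    (XXZ.torus_degree_le d (2 * M)) (r := η * L) (by positivity) hT
    (by rw [← hκ]; exact (mul_div_cancel₀ _ hκ0.ne').le) hβ
  refine h.trans (Real.exp_le_exp.2 ?_)
  rw [← hκ]
  set n : ℝ := ((Finset.univ.filter fun i : XXZ.box d (2 * M) =>
    (XXZ.siteWeight d M L i : ℝ) < η * L).card : ℝ) with hn
  set E : ℝ := ((XXZ.torus d (2 * M)).edgeFinset.card : ℝ) with hE
  have hnle : n ≤ 12 * d * η * (2 * M : ℝ) ^ d := by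
    have h1 := XXZ.card_siteWeight_lt_le d M (R := ⌈η * L⌉₊) hL1 hLM
    have h2 : n ≤ ((Finset.univ.filter fun i : XXZ.box d (2 * M) =>
        XXZ.siteWeight d M L i < ⌈η * L⌉₊).card : ℝ) := by
      rw [hn]
      refine Nat.cast_le.2 (Finset.card_le_card fun i hi => ?_)
      simp only [Finset.mem_filter, Finset.mem_univ, true_and] at hi ⊢
      have := hi.trans_le (Nat.le_ceil (η * L))
      exact_mod_cast this
    have h3 : (⌈η * L⌉₊ : ℝ) / L ≤ 2 * η := by
      rw [div_le_iff₀ hLpos]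
      have := Nat.ceil_lt_add_one (by positivity : 0 ≤ η * L)
      linarith
    calc n ≤ 6 * d * (⌈η * L⌉₊ / L) * (2 * M : ℝ) ^ d := h2.trans h1
      _ ≤ 6 * d * (2 * η) * (2 * M : ℝ) ^ d := by gcongr
      _ = _ := by ring
  have hEge : (2 * M : ℝ) ^ d / 2 ≤ E := by
    have h1 : ((2 * M : ℝ) ^ d) ≤ 2 * E := by
      have h := (Nat.cast_le (α := ℝ)).2
        (XXZ.card_le_two_mul_card_edgeFinset d M (by omega))
      push_cast at h
      exact h
    linarith
  have hmin : min (η / κ) 1 * min (L : ℝ) β ≤ min (η * L / κ) β := by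
    have h0 : 0 ≤ min (L : ℝ) β := le_min hLpos.le hβ
    refine le_min ?_ ?_
    · calc _ ≤ η / κ * L := mul_le_mul (min_le_left _ _) (min_le_left _ _) h0 (by positivity)
        _ = _ := by ring
    · calc _ ≤ 1 * β := mul_le_mul (min_le_right _ _) (min_le_right _ _) h0 zero_le_one
        _ = _ := one_mul β
  have hrate : (1 - Δ) / 16 * (2 * M : ℝ) ^ d ≤ (1 - Δ) / 4 * E - κ * n := by
    have h1 := mul_le_mul_of_nonneg_left hEge (by positivity : 0 ≤ (1 - Δ) / 4)
    have h2 := mul_le_mul_of_nonneg_left hnle hκ0.le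
    have h3 : κ * (12 * d * η * (2 * M : ℝ) ^ d) = (1 - Δ) / 16 * (2 * M : ℝ) ^ d := by
      rw [← hηκ]; ring
    linarith
  have hmin0 : 0 ≤ min (η * L / κ) β := le_min hT.le hβ
  have hfinal : (1 - Δ) / 16 * (2 * M : ℝ) ^ d * (min (η / κ) 1 * min (L : ℝ) β) ≤
      ((1 - Δ) / 4 * E - κ * n) * min (η * L / κ) β :=
    (mul_le_mul_of_nonneg_left hmin (by positivity)).trans
      (mul_le_mul_of_nonneg_right hrate hmin0)
  push_cast
  linarith
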